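/- Let $\mathbb R^\infty=\bigcup_{n\ge 1}\mathbb R^n$. An additive machine has real registers $Z_1,Z_2,\dots$, index registers $I_1,I_2,\dots$ (finitely many of them used) and a finite program of labelled instructions $Z_i:=Z_j+Z_k$, $Z_i:=Z_j-Z_k$, $Z_i:=0$, $Z_i:=1$, $Z_{I_j}:=Z_{I_k}$, $I_j:=1$, $I_j:=I_j+1$, "if $I_j=I_k$ then goto $l_1$ else goto $l_2$", tests on real registers, and stop. On input $(x_1,\dots,x_n)\in\mathbb R^\infty$ it starts with $Z_i=x_i$ for $i\le n$, $Z_i=0$ for $i>n$, and all index registers equal to $n$; when it halts, its output is $(Z_1,\dots,Z_{I_1})$. Let $\mathsf M_{\rm add}^{1,=}$ be the class of these machines whose tests on real registers are equality tests "if $Z_j=0$ then goto $l_1$ else goto $l_2$", $\mathsf M_{\rm add}^{1}$ the class of those whose tests on real registers are order tests "if $Z_j\ge 0$ then goto $l_1$ else goto $l_2$", and, for $\mathcal O\subseteq\mathbb R^\infty$, $\mathsf M_{\rm add}^{1}(\mathcal O)$ the class of machines that may use, in addition to the instructions allowed in $\mathsf M_{\rm add}^{1}$, the instruction "if $(Z_1,\dots,Z_{I_1})\in\mathcal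 O$ then goto $l_1$ else goto $l_2$". A machine accepts (rejects) an input if it halts on it with output $1$ (output $0$). It decides $P\subseteq\mathbb R^\infty$ if it accepts every element of $P$ and rejects every element of $\mathbb R^\infty\setminus P$; it semi-decides $P$ if it accepts every element of $P$ and does not halt on any element of $\mathbb R^\infty\setminus P$. Write $\mathcal A\preceq\mathcal B$ if some machine in $\mathsf M_{\rm add}^{1}(\mathcal B)$ decides $\mathcal A$, and $\mathcal A\precneqq\mathcal B$ if $\mathcal A\preceq\mathcal B$ and not $\mathcal B\preceq\mathcal A$. Programs are words over a finite alphabet; encoding each symbol injectively by a $0$-$1$-string of one fixed length gives an unambiguous code $\mathrm{code}(\mathcal M)$, a finite tuple of zeros and ones. Writing $(n\,.\,\vec x\,.\,\vec s)$ for the concatenated tuple $(n,x_1,\dots,x_n,s_1,\dots,s_m)$, put $$\mathbb H_{\rm add}^{1,=}=\bigcup_{n\ge1}\{(n\,.\,\vec x\,.\,\mathrm{code}(\mathcal N)) : \vec x\in\mathbb R^n,\ \mathcal N\in\mathsf M_{\rm add}^{1,=},\ \mathcal N\text{ halts on }\vec x\}.$$ Let $p_1=2,p_2=3,\dots$ be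 the prime numbers. For a machine $\mathcal K\in\mathsf M_{\rm add}^{1}$ that semi-decides $\bigcup_{i\ge1}\{i\}\times(\mathbb R\setminus\{\sqrt{p_i}\})$ let $$\mathbb P_i=\{(2\,.\,(i,x)\,.\,\mathrm{code}(\mathcal K)) : x\in\mathbb R\setminus\{\sqrt{p_i}\}\},\qquad \mathbb H_i=\mathbb H_{\rm add}^{1,=}\cup\bigcup_{1\le j\le i}\mathbb P_j .$$ Then the following hold. 1. If $\mathcal M\in\mathsf M_{\rm add}^{1}(\mathbb H_{\rm add}^{1,=})$ decides a problem $S\subseteq\mathbb R$ (regarded as a subset of $\mathbb R^1\subseteq\mathbb R^\infty$), then there are positive integers $n,m$ such that $\mathcal M$ rejects both inputs $\sqrt2$ and $\frac nm\pi$, or $\mathcal M$ accepts both of these inputs. 2. The problem $\{\sqrt2\}$ is not decidable by a machine in $\mathsf M_{\rm add}^{1}(\mathbb H_{\rm add}^{1,=})$. 3. There are machines $\mathcal K$ as above, and for each of them $\mathbb H_{\rm add}^{1,=}\precneqq\mathbb H_1$. -/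

import Mathlib

namespace AddBSS

/-- Instructions of the additive machines with the constants 0 and 1. The real registers
`Z_1, Z_2, …` and the index registers `I_1, I_2, …` are numbered from `0` here: the argument `i`
stands for `Z_{i+1}`, respectively `I_{i+1}`. Labels are positions in the program. -/
inductive Instr where
  /-- `Z_i := Z_j + Z_k` -/
  | add (i j k : ℕ)
  /-- `Z_i := Z_j - Z_k` -/
  | sub (i j k : ℕ)
  /-- `Z_i := 0` -/
  | setZero (i : ℕ)
  /-- `Z_i := 1` -/
  | setOne (i : ℕ)
  /-- `if Z_j = 0 then goto l₁ else goto l₂` -/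
  | ifEq (j l₁ l₂ : ℕ)
  /-- `if Z_j ≥ 0 then goto l₁ else goto l₂` -/
  | ifGe (j l₁ l₂ : ℕ)
  /-- `Z_{I_j} := Z_{I_k}` -/
  | copy (j k : ℕ)
  /-- `I_j := 1` -/
  | idxOne (j : ℕ)
  /-- `I_j := I_j + 1` -/
  | idxSucc (j : ℕ)
  /-- `if I_j = I_k then goto l₁ else goto l₂` -/
  | ifIdx (j k l₁ l₂ : ℕ)
  /-- `if (Z_1, …, Z_{I_1}) ∈ O then goto l₁ else goto l₂` -/
  | query (l₁ l₂ : ℕ)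

/-- A machine is given by its program, a finite list of instructions labelled `0, 1, 2, …`,
which is followed by the instruction `stop`: a machine halts when its label leaves the list.
Only finitely many index registers occur in a program. -/
abbrev Machine := List Instr

/-- No equality test between real numbers occurs; order tests, constants 0 and 1 and oracle
queries are allowed. This is the class `M_add^1(O)` of oracle machines. -/
def IsOrdOracleMachine (M : Machine) : Prop :=
  ∀ j l₁ l₂, Instr.ifEq j l₁ l₂ ∉ M

/-- The class `M_add^1`: order tests only, and no oracle queries. -/
def IsOrdMachine (M : Machine) : Prop :=
  IsOrdOracleMachine M ∧ ∀ l₁ l₂, Instr.query l₁ l₂ ∉ M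

/-- The class `M_add^{1,=}`: equality tests only, and no oracle queries. -/
def IsEqMachine (M : Machine) : Prop :=
  (∀ j l₁ l₂, Instr.ifGe j l₁ l₂ ∉ M) ∧ ∀ l₁ l₂, Instr.query l₁ l₂ ∉ M

/-- A configuration: current label, contents of the real registers (`Z i` is the content of
`Z_{i+1}`) and of the index registers (`I j` is the content of `I_{j+1}`; these contents are
positive integers throughout every computation). -/
structure Config where
  pc : ℕ
  Z : ℕ → ℝ
  I : ℕ → ℕ

/-- The tuple `(Z_1, …, Z_{I_1})`, used in oracle queries and as the output. -/
def Config.tuple (c : Config) : List ℝ := (List.range (c.I 0)).map c.Z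

open Classical in
/-- Execution of one instruction with the oracle `O`. -/
noncomputable def exec (O : Set (List ℝ)) (c : Config) : Instr → Config
  | .add i j k => ⟨c.pc + 1, Function.update c.Z i (c.Z j + c.Z k), c.I⟩
  | .sub i j k => ⟨c.pc + 1, Function.update c.Z i (c.Z j - c.Z k), c.I⟩
  | .setZero i => ⟨c.pc + 1, Function.update c.Z i 0, c.I⟩
  | .setOne i => ⟨c.pc + 1, Function.update c.Z i 1, c.I⟩
  | .ifEq j l₁ l₂ => ⟨if c.Z j = 0 then l₁ else l₂, c.Z, c.I⟩
  | .ifGe j l₁ l₂ => ⟨if c.Z j ≥ 0 then l₁ else l₂, c.Z, c.I⟩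
  | .copy j k => ⟨c.pc + 1, Function.update c.Z (c.I j - 1) (c.Z (c.I k - 1)), c.I⟩
  | .idxOne j => ⟨c.pc + 1, c.Z, Function.update c.I j 1⟩
  | .idxSucc j => ⟨c.pc + 1, c.Z, Function.update c.I j (c.I j + 1)⟩
  | .ifIdx j k l₁ l₂ => ⟨if c.I j = c.I k then l₁ else l₂, c.Z, c.I⟩
  | .query l₁ l₂ => ⟨if c.tuple ∈ O then l₁ else l₂, c.Z, c.I⟩

/-- One step of `M` with the oracle `O`; a configuration whose label is outside the program is
final and does not change any more. -/
noncomputable def step (O : Set (List ℝ)) (M : Machine) (c : Config) : Config :=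
  match M[c.pc]? with
  | some a => exec O c a
  | none => c

/-- The initial configuration for the input `x = (x_1, …, x_n)`: `Z_i := x_i` for `i ≤ n`, the
other real registers contain `0`, and all index registers contain `n`. -/
def init (x : List ℝ) : Config :=
  ⟨0, fun i => x.getD i 0, fun _ => x.length⟩

/-- `M` with the oracle `O` halts on `x` with the output `y`. -/
def Outputs (O : Set (List ℝ)) (M : Machine) (x y : List ℝ) : Prop :=
  ∃ t : ℕ, M.length ≤ ((step O M)^[t] (init x)).pc ∧ ((step O M)^[t] (init x)).tuple = y

/-- `M` with the oracle `O` halts on `x`. -/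
def Halts (O : Set (List ℝ)) (M : Machine) (x : List ℝ) : Prop :=
  ∃ t : ℕ, M.length ≤ ((step O M)^[t] (init x)).pc

/-- Acceptance: output `1`. -/
def Accepts (O : Set (List ℝ)) (M : Machine) (x : List ℝ) : Prop := Outputs O M x [1]

/-- Rejection: output `0`. -/
def Rejects (O : Set (List ℝ)) (M : Machine) (x : List ℝ) : Prop := Outputs O M x [0]

/-- `M` with the oracle `O` decides `P ⊆ ℝ^∞ = ⋃_{n ≥ 1} ℝ^n`, i.e. it computes the
characteristic function of `P`. Elements of `ℝ^∞` are non-empty lists. -/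
def Decides (O : Set (List ℝ)) (M : Machine) (P : Set (List ℝ)) : Prop :=
  ∀ x : List ℝ, x ≠ [] → (x ∈ P → Accepts O M x) ∧ (x ∉ P → Rejects O M x)

/-- `M` (without oracle) semi-decides `P ⊆ ℝ^∞`, i.e. it computes the partial characteristic
function of `P`. -/
def SemiDecides (M : Machine) (P : Set (List ℝ)) : Prop :=
  ∀ x : List ℝ, x ≠ [] → (x ∈ P → Accepts ∅ M x) ∧ (x ∉ P → ¬ Halts ∅ M x)

/-- `A ⪯ B`: `A` is decided by a machine in `M_add^1(B)`. -/
def Reducible (A B : Set (List ℝ)) : Prop :=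
  ∃ M : Machine, IsOrdOracleMachine M ∧ Decides B M A

/-- `A` is strictly easier than `B`. -/
def StrictlyReducible (A B : Set (List ℝ)) : Prop :=
  Reducible A B ∧ ¬ Reducible B A

/-- A set of real numbers as a subset of `ℝ^1 ⊆ ℝ^∞`. -/
def asProblem (S : Set ℝ) : Set (List ℝ) := {z | ∃ x ∈ S, z = [x]}

/-- The symbols of which programs are written. -/
inductive Symb where
  | digit0 | digit1 | regZ | regI | assign | plus | minus | eq | ge | goto | oracle | sep | halt

/-- Every symbol is encoded by four symbols in `{0, 1}`. -/
def Symb.bits : Symb → List ℝ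
  | .digit0 => [0, 0, 0, 0]
  | .digit1 => [0, 0, 0, 1]
  | .regZ => [0, 0, 1, 0]
  | .regI => [0, 0, 1, 1]
  | .assign => [0, 1, 0, 0]
  | .plus => [0, 1, 0, 1]
  | .minus => [0, 1, 1, 0]
  | .eq => [0, 1, 1, 1]
  | .ge => [1, 0, 0, 0]
  | .goto => [1, 0, 0, 1]
  | .oracle => [1, 0, 1, 0]
  | .sep => [1, 0, 1, 1]
  | .halt => [1, 1, 0, 0]

/-- Binary numeral (least significant digit first), closed by a separator. -/
def numeral (n : ℕ) : List Symb :=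
  n.bits.map (fun b => if b then Symb.digit1 else Symb.digit0) ++ [Symb.sep]

/-- The text of an instruction. -/
def Instr.text : Instr → List Symb
  | .add i j k => .regZ :: numeral i ++ .assign :: .regZ :: numeral j ++ .plus :: numeral k
  | .sub i j k => .regZ :: numeral i ++ .assign :: .regZ :: numeral j ++ .minus :: numeral k
  | .setZero i => .regZ :: numeral i ++ [.assign, .digit0]
  | .setOne i => .regZ :: numeral i ++ [.assign, .digit1]
  | .ifEq j l₁ l₂ => .goto :: .eq :: numeral j ++ numeral l₁ ++ numeral l₂
  | .ifGe j l₁ l₂ => .goto :: .ge :: numeral j ++ numeral l₁ ++ numeral l₂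
  | .copy j k => .regZ :: .regI :: numeral j ++ .assign :: numeral k
  | .idxOne j => .regI :: numeral j ++ [.assign]
  | .idxSucc j => .regI :: numeral j ++ [.plus]
  | .ifIdx j k l₁ l₂ => .goto :: .regI :: numeral j ++ numeral k ++ numeral l₁ ++ numeral l₂
  | .query l₁ l₂ => .goto :: .oracle :: numeral l₁ ++ numeral l₂

/-- The code of a machine, a tuple of zeros and ones. -/
def code (M : Machine) : List ℝ :=
  (M.flatMap Instr.text ++ [Symb.halt]).flatMap Symb.bits

theorem numeral_inj {n m : ℕ} {u v : List Symb} (h : numeral n ++ u = numeral m ++ v) :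
    n = m ∧ u = v := by
  have key : ∀ (a b : List Bool) (u v : List Symb),
      a.map (fun b => if b then Symb.digit1 else Symb.digit0) ++ Symb.sep :: u =
        b.map (fun b => if b then Symb.digit1 else Symb.digit0) ++ Symb.sep :: v →
      a = b ∧ u = v := by
    intro a
    induction a with
    | nil => intro b u v h; cases b with
      | nil => simpa using h
      | cons y b => cases y <;> simp at h
    | cons x a ih => intro b u v h; cases b with
      | nil => cases x <;> simp at h
      | cons y b =>
        cases x <;> cases y <;> simp at h <;> have := ih b u v (by simpa using h) <;> simpa using this
  have := key n.bits m.bits u v (by simpa [numeral] using h)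
  refine ⟨?_, this.2⟩
  exact (Nat.digits_inj_iff (b := 2)).1 (by rw [Nat.digits_two_eq_bits, Nat.digits_two_eq_bits, this.1])

theorem numeral_ne {n : ℕ} {s : Symb} {u v : List Symb} (h : numeral n ++ u = s :: v) :
    s = .digit0 ∨ s = .digit1 ∨ s = .sep := by
  unfold numeral at h
  generalize n.bits = l at h
  rcases l with _ | ⟨b, l⟩
  · simp at h; simp [← h.1]
  · cases b <;> simp at h <;> simp [← h.1]

theorem Instr.text_inj (a b : Instr) {u v : List Symb} (h : a.text ++ u = b.text ++ v) :
    a = b ∧ u = v := by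
  cases a <;> cases b <;> simp [Instr.text, List.append_assoc] at h ⊢ <;>
  first
  | exact h
  | (obtain ⟨h1, h⟩ := numeral_inj h
     first
     | exact ⟨h1, h⟩
     | (simp at h; done)
     | (simp at h; exact ⟨h1, h⟩)
     | (try simp only [List.cons.injEq, true_and] at h
        obtain ⟨h2, h⟩ := numeral_inj h
        first
        | exact ⟨⟨h1, h2⟩, h⟩
        | (simp at h; done)
        | (try simp only [List.cons.injEq, true_and] at h
           obtain ⟨h3, h⟩ := numeral_inj h
           first
           | exact ⟨⟨h1, h2, h3⟩, h⟩
           | (obtain ⟨h4, h⟩ := numeral_inj h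
              exact ⟨⟨h1, h2, h3, h4⟩, h⟩))))
  | (have := numeral_ne h; simp at this)
  | (have := numeral_ne h.symm; simp at this)

/-- Programs are encoded unambiguously. -/
theorem code_injective : Function.Injective code := by
  have hb : ∀ s t : List Symb, s.flatMap Symb.bits = t.flatMap Symb.bits → s = t := by
    intro s
    induction s with
    | nil => intro t h; cases t with
      | nil => rfl
      | cons b t => cases b <;> simp [Symb.bits] at h
    | cons a s ih => intro t h; cases t with
      | nil => cases a <;> simp [Symb.bits] at h
      | cons b t =>
        cases a <;> cases b <;> simp [Symb.bits] at h <;> simp [ih t h]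
  intro M N h
  have h := hb _ _ h
  induction M generalizing N with
  | nil => cases N with
    | nil => rfl
    | cons b N => cases b <;> simp [Instr.text] at h
  | cons a M ih => cases N with
    | nil => cases a <;> simp [Instr.text] at h
    | cons b N =>
      simp only [List.flatMap_cons, List.append_assoc] at h
      obtain ⟨h1, h2⟩ := Instr.text_inj a b h
      rw [h1, ih (by simp [code, h2]) h2]

/-- The halting problem `H_add^{1,=}`: all tuples `(n . x . code N)` such that `x ∈ ℝ^n`, `n ≥ 1`,
and the machine `N ∈ M_add^{1,=}` halts on `x`. -/
def haltEq : Set (List ℝ) :=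
  {z | ∃ (x : List ℝ) (N : Machine), x ≠ [] ∧ IsEqMachine N ∧ Halts ∅ N x ∧
    z = (x.length : ℝ) :: (x ++ code N)}

/-- The square root of the `i`-th prime, `i ≥ 1` (so `p_1 = 2`, `p_2 = 3`, …). -/
noncomputable def rootPrime (i : ℕ) : ℝ := Real.sqrt (Nat.nth Nat.Prime (i - 1) : ℝ)

/-- The problem `⋃_{i ≥ 1} {i} × (ℝ ∖ {√p_i})`. -/
def notRoot : Set (List ℝ) :=
  {z | ∃ i : ℕ, 1 ≤ i ∧ ∃ x : ℝ, x ≠ rootPrime i ∧ z = [(i : ℝ), x]}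

/-- `P_i = {(2 . (i, x) . code K) | x ∈ ℝ ∖ {√p_i}}`. -/
def haltRoot (K : Machine) (i : ℕ) : Set (List ℝ) :=
  {z | ∃ x : ℝ, x ≠ rootPrime i ∧ z = (2 : ℝ) :: ([(i : ℝ), x] ++ code K)}

/-- `H_i = H_add^{1,=} ∪ ⋃_{1 ≤ j ≤ i} P_j`. -/
def haltLevel (K : Machine) (i : ℕ) : Set (List ℝ) :=
  haltEq ∪ ⋃ j ∈ Set.Icc 1 i, haltRoot K j

/-- A machine for `notRoot`. The instructions `0, …, 18` find the `i`-th prime `p` (trying the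
successive divisors of each candidate); for `q = 1, 2, …`, the instructions `19, …, 37` determine
the integer `r` with `r ≤ q √p < r + 1` and accept the input `(i, x)` as soon as `q x < r` or
`q x > r + 1`. -/
def rootMachine : Machine :=
  [.idxOne 1, .idxSucc 1, .ifIdx 0 1 3 2, .setOne 6, .setOne 2,
   .add 2 2 6, .setOne 4, .add 4 4 6, .add 5 2 8, .sub 5 5 4,
   .ifGe 5 11 7, .sub 7 8 5, .ifGe 7 13 9, .sub 7 4 2, .ifGe 7 15 5,
   .sub 0 0 6, .ifGe 0 17 5, .sub 7 8 0, .ifGe 7 19 5, .add 11 2 8,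
   .add 15 2 2, .setOne 13, .add 16 6 6, .add 14 16 6, .add 10 10 11,
   .add 11 11 15, .add 9 9 1, .sub 7 10 13, .ifGe 7 29 33, .add 12 12 6,
   .add 13 13 14, .add 14 14 16, .ifGe 6 27 27, .sub 7 9 12, .ifGe 7 35 38,
   .add 7 12 6, .sub 7 7 9, .ifGe 7 24 38, .idxOne 0, .setOne 0]

/-- `c'` is reached from `c` in at least one step. -/
def Reach (c c' : Config) : Prop := ∃ t, 0 < t ∧ (step ∅ rootMachine)^[t] c = c'

theorem Reach.trans {a b c : Config} (h : Reach a b) (h' : Reach b c) : Reach a c := by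
  obtain ⟨s, hs, rfl⟩ := h
  obtain ⟨t, ht, rfl⟩ := h'
  exact ⟨t + s, by omega, Function.iterate_add_apply _ _ _ _⟩

theorem not_halts_of_loop (S : Config → Prop) (hS : ∀ c, S c → c.pc < 40)
    (hS' : ∀ c, S c → ∃ c', Reach c c' ∧ S c') {x : List ℝ} {c : Config}
    (hc : Reach (init x) c) (h : S c) : ¬ Halts ∅ rootMachine x := by
  rintro ⟨t, ht⟩
  have late : ∀ n : ℕ, ∃ s, n ≤ s ∧ S ((step ∅ rootMachine)^[s] (init x)) := by
    intro n
    induction n with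
    | zero => obtain ⟨s, _, rfl⟩ := hc; exact ⟨s, by omega, h⟩
    | succ n ih =>
      obtain ⟨s, hs, h⟩ := ih
      obtain ⟨c', ⟨u, hu, rfl⟩, h'⟩ := hS' _ h
      exact ⟨u + s, by omega, by rwa [Function.iterate_add_apply]⟩
  obtain ⟨s, hs, h⟩ := late t
  have fix : ∀ k, (step ∅ rootMachine)^[k + t] (init x) = (step ∅ rootMachine)^[t] (init x) := by
    intro k
    induction k with
    | zero => simp
    | succ k ih =>
      rw [show k + 1 + t = (k + t) + 1 by omega, Function.iterate_succ_apply', ih, step,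
        List.getElem?_eq_none ht]
  have := hS _ h
  rw [← Nat.sub_add_cancel hs, fix] at this
  have : rootMachine.length = 40 := rfl
  omega

/-- The registers while the prime is searched: `p` is the current candidate, and the `j`-th prime
after `p` has to be found. -/
structure Search (x j : ℝ) (p : ℕ) (c : Config) : Prop where
  z0 : c.Z 0 = j
  z1 : c.Z 1 = x
  z2 : c.Z 2 = p
  z6 : c.Z 6 = 1
  z8 : c.Z 8 = 0
  z9 : c.Z 9 = 0
  z10 : c.Z 10 = 0
  z12 : c.Z 12 = 0

theorem search_inner {x j : ℝ} {p t : ℕ} (ht : 0 < t) (r : ℕ) (hr : 0 < r) (c : Config)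
    (hc : Search x j p c) (hpc : c.pc = 9) (h4 : c.Z 4 = t) (h5 : c.Z 5 = r) :
    ∃ c', Reach c c' ∧ Search x j p c' ∧ c'.Z 4 = t ∧ c'.pc = if t ∣ r then 13 else 7 := by
  induction r using Nat.strong_induction_on generalizing c with
  | _ r ih =>
  obtain ⟨pc, Z, I⟩ := c
  obtain ⟨h0, h1, h2, h6, h8, h9, h10, h12⟩ := hc
  dsimp only at *
  subst hpc
  rcases lt_trichotomy r t with hlt | heq | hgt
  · have hd : ¬ t ∣ r := fun h => by have := Nat.le_of_dvd hr h; omega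
    refine ⟨_, ⟨2, by norm_num, rfl⟩, ?_⟩
    have e : (step ∅ rootMachine)^[2] ⟨9, Z, I⟩ =
        ⟨7, Function.update Z 5 (Z 5 - Z 4), I⟩ := by
      simp [step, exec, rootMachine, h4, h5, hlt]
    rw [e]
    exact ⟨by constructor <;> simpa, by simpa, by simp [hd]⟩
  · subst heq
    refine ⟨_, ⟨4, by norm_num, rfl⟩, ?_⟩
    have e : (step ∅ rootMachine)^[4] ⟨9, Z, I⟩ =
        ⟨13, Function.update (Function.update Z 5 0) 7 0, I⟩ := by
      simp [step, exec, rootMachine, h4, h5, h8]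
    rw [e]
    exact ⟨by constructor <;> simpa, by simpa, by simp⟩
  · have e : (step ∅ rootMachine)^[4] ⟨9, Z, I⟩ =
        ⟨9, Function.update (Function.update Z 5 (r - t)) 7 (t - r), I⟩ := by
      simp [step, exec, rootMachine, h4, h5, h8, hgt, hgt.le]
    obtain ⟨c', hR, h⟩ := ih (r - t) (by omega) (by omega)
      ⟨9, Function.update (Function.update Z 5 (r - t)) 7 (t - r), I⟩
      (by constructor <;> simpa) rfl (by simpa) (by simp [Nat.cast_sub hgt.le])
    refine ⟨c', Reach.trans ⟨4, by norm_num, e⟩ hR, ?_⟩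
    simpa [show t ∣ r - t ↔ t ∣ r from Nat.dvd_sub_iff_left hgt.le dvd_rfl] using h

theorem search_divisor {x j : ℝ} {p : ℕ} (hp : 2 ≤ p) (d : ℕ) : ∀ (t : ℕ) (c : Config),
    0 < t → t < p.minFac → p.minFac - t = d → Search x j p c → c.pc = 7 → c.Z 4 = t →
    ∃ c', Reach c c' ∧ Search x j p c' ∧ c'.Z 4 = p.minFac ∧ c'.pc = 13 := by
  induction d with
  | zero => intro t c _ h1 h2; omega
  | succ d ih =>
    rintro t ⟨pc, Z, I⟩ ht htp hd ⟨h0, h1, h2, h6, h8, h9, h10, h12⟩ hpc h4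
    dsimp only at *
    subst hpc
    have e : (step ∅ rootMachine)^[2] ⟨7, Z, I⟩ =
        ⟨9, Function.update (Function.update Z 4 (t + 1)) 5 p, I⟩ := by
      simp [step, exec, rootMachine, h4, h6, h8, h2]
    obtain ⟨c', hR, hS, h4', hpc'⟩ := search_inner (x := x) (j := j) (p := p) (t := t + 1)
      (by omega) p (by omega) ⟨9, Function.update (Function.update Z 4 (t + 1)) 5 p, I⟩
      (by constructor <;> simpa) rfl (by simp) (by simp)
    have hR := Reach.trans ⟨2, by norm_num, e⟩ hR
    by_cases hdvd : t + 1 ∣ p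
    · have : p.minFac = t + 1 := le_antisymm (Nat.minFac_le_of_dvd (by omega) hdvd) htp
      exact ⟨c', hR, hS, by rw [h4', this], by rw [hpc', if_pos hdvd]⟩
    · have hne : t + 1 ≠ p.minFac := fun h => hdvd (h ▸ Nat.minFac_dvd p)
      rw [if_neg hdvd] at hpc'
      obtain ⟨c'', hR', h⟩ := ih (t + 1) c' (by omega) (by omega) (by omega) hS hpc' h4'
      exact ⟨c'', hR.trans hR', h⟩

/-- One round of the search for the prime. -/
theorem search_round {x j : ℝ} {p : ℕ} (hp : 1 ≤ p) {c : Config}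
    (hc : Search x j p c) (hpc : c.pc = 5) :
    ∃ c', Reach c c' ∧ ((¬ (p + 1).Prime ∧ Search x j (p + 1) c' ∧ c'.pc = 5) ∨
      ((p + 1).Prime ∧ Search x (j - 1) (p + 1) c' ∧ c'.pc = if j = 1 then 19 else 5)) := by
  obtain ⟨pc, Z, I⟩ := c
  obtain ⟨h0, h1, h2, h6, h8, h9, h10, h12⟩ := hc
  dsimp only at *
  subst hpc
  have e : (step ∅ rootMachine)^[2] ⟨5, Z, I⟩ =
      ⟨7, Function.update (Function.update Z 2 (p + 1)) 4 1, I⟩ := by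
    simp [step, exec, rootMachine, h6, h2]
  have h2p : 2 ≤ p + 1 := by omega
  obtain ⟨⟨pc, Z', I'⟩, hR, hS, h4', hpc'⟩ := search_divisor (x := x) (j := j) h2p _ 1
    ⟨7, Function.update (Function.update Z 2 (p + 1)) 4 1, I⟩ one_pos
    (Nat.minFac_prime (by omega)).one_lt rfl (by constructor <;> simpa) rfl (by simp)
  have hR := Reach.trans ⟨2, by norm_num, e⟩ hR
  clear e h0 h1 h2 h6 h8 h9 h10 h12
  obtain ⟨h0, h1, h2, h6, h8, h9, h10, h12⟩ := hS
  dsimp only at *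
  subst hpc'
  by_cases hprime : (p + 1).Prime
  · rw [hprime.minFac_eq] at h4'
    by_cases hj : j = 1
    · have e : (step ∅ rootMachine)^[6] ⟨13, Z', I'⟩ =
          ⟨19, Function.update (Function.update (Function.update Z' 7 0) 0 0) 7 0, I'⟩ := by
        simp [step, exec, rootMachine, h4', h2, h0, h6, h8, hj]
      refine ⟨_, hR.trans ⟨6, by norm_num, e⟩, Or.inr ⟨hprime, ?_, by simp [hj]⟩⟩
      constructor <;> simp [hj, *]
    · by_cases hj' : 1 ≤ j
      · have e : (step ∅ rootMachine)^[6] ⟨13, Z', I'⟩ =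
            ⟨5, Function.update (Function.update (Function.update Z' 7 0) 0 (j - 1)) 7
              (1 - j), I'⟩ := by
          have : ¬ j ≤ 1 := fun h => hj (le_antisymm h hj')
          simp [step, exec, rootMachine, h4', h2, h0, h6, h8, hj', this]
        refine ⟨_, hR.trans ⟨6, by norm_num, e⟩, Or.inr ⟨hprime, ?_, by simp [hj]⟩⟩
        constructor <;> simp [*]
      · have e : (step ∅ rootMachine)^[4] ⟨13, Z', I'⟩ =
            ⟨5, Function.update (Function.update Z' 7 0) 0 (j - 1), I'⟩ := by
          simp [step, exec, rootMachine, h4', h2, h0, h6, hj']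
        refine ⟨_, hR.trans ⟨4, by norm_num, e⟩, Or.inr ⟨hprime, ?_, by simp [hj]⟩⟩
        constructor <;> simp [*]
  · have hlt : (p + 1).minFac < p + 1 := (Nat.not_prime_iff_minFac_lt h2p).1 hprime
    have hlt : ¬ ((p : ℝ) + 1 ≤ (p + 1).minFac) := by
      rw [not_le]; exact_mod_cast hlt
    have e : (step ∅ rootMachine)^[2] ⟨13, Z', I'⟩ =
        ⟨5, Function.update Z' 7 ((p + 1).minFac - (p + 1)), I'⟩ := by
      simp [step, exec, rootMachine, h4', h2, hlt]
    refine ⟨_, hR.trans ⟨2, by norm_num, e⟩, Or.inl ⟨hprime, ?_, rfl⟩⟩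
    constructor <;> simp [*]

theorem search_prime {x : ℝ} {k : ℕ} (d : ℕ) : ∀ (p i : ℕ) (c : Config), 1 ≤ p → 1 ≤ i →
    Nat.count Nat.Prime (p + 1) + i = k + 1 → Nat.nth Nat.Prime k - p = d →
    Search x i p c → c.pc = 5 →
    ∃ c', Reach c c' ∧ Search x 0 (Nat.nth Nat.Prime k) c' ∧ c'.pc = 19 := by
  induction d with
  | zero =>
    intro p i c _ hi hk hd
    have : p + 1 ≤ Nat.nth Nat.Prime k :=
      (Nat.count_le_iff_le_nth Nat.infinite_setOfPred_prime).1 (by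
        change Nat.count Nat.Prime (p + 1) ≤ k
        omega)
    omega
  | succ d ih =>
    intro p i c hp hi hk hd hc hpc
    obtain ⟨c', hR, ⟨hpr, hS, hpc'⟩ | ⟨hpr, hS, hpc'⟩⟩ := search_round hp hc hpc
    · obtain ⟨c'', hR', h⟩ := ih (p + 1) i c' (by omega) hi
        (by rw [Nat.count_succ, if_neg hpr]; omega) (by omega) hS hpc'
      exact ⟨c'', hR.trans hR', h⟩
    · by_cases h1 : i = 1
      · have : Nat.nth Nat.Prime k = p + 1 := by
          rw [show k = Nat.count Nat.Prime (p + 1) by omega, Nat.nth_count hpr]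
        rw [this]
        subst h1
        exact ⟨c', hR, by simpa using hS, by simpa using hpc'⟩
      · obtain ⟨c'', hR', h⟩ := ih (p + 1) (i - 1) c' (by omega) (by omega)
          (by rw [Nat.count_succ, if_pos hpr]; omega) (by omega)
          (by rwa [Nat.cast_sub hi, Nat.cast_one]) (by simpa [h1] using hpc')
        exact ⟨c'', hR.trans hR', h⟩

/-- The registers in the second phase. -/
structure Approx (x : ℝ) (p q r : ℕ) (c : Config) : Prop where
  z1 : c.Z 1 = x
  z6 : c.Z 6 = 1
  z9 : c.Z 9 = q * x
  z10 : c.Z 10 = p * q ^ 2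
  z11 : c.Z 11 = p * (2 * q + 1)
  z12 : c.Z 12 = r
  z13 : c.Z 13 = (r + 1) ^ 2
  z14 : c.Z 14 = 2 * r + 3
  z15 : c.Z 15 = 2 * p
  z16 : c.Z 16 = 2
  le : r ^ 2 ≤ p * q ^ 2

theorem approx_inner {x : ℝ} {p q : ℕ} (d : ℕ) : ∀ (r : ℕ) (c : Config), p * q ^ 2 - r = d →
    Approx x p q r c → c.pc = 27 →
    ∃ c' r', Reach c c' ∧ Approx x p q r' c' ∧ p * q ^ 2 < (r' + 1) ^ 2 ∧ c'.pc = 33 := by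
  induction d with
  | zero =>
    rintro r ⟨pc, Z, I⟩ hd ⟨h1, h6, h9, h10, h11, h12, h13, h14, h15, h16, hle⟩ hpc
    dsimp only at *
    subst hpc
    have hlt : p * q ^ 2 < (r + 1) ^ 2 := by nlinarith [Nat.sub_eq_zero_iff_le.1 hd]
    have hn : ¬ (((r : ℝ) + 1) ^ 2 ≤ p * q ^ 2) := by rw [not_le]; exact_mod_cast hlt
    refine ⟨_, r, ⟨2, by norm_num, rfl⟩, ?_⟩
    have e : (step ∅ rootMachine)^[2] ⟨27, Z, I⟩ =
        ⟨33, Function.update Z 7 (p * q ^ 2 - (r + 1) ^ 2), I⟩ := by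
      simp [step, exec, rootMachine, h10, h13, hn]
    rw [e]
    exact ⟨by constructor <;> simpa, hlt, rfl⟩
  | succ d ih =>
    rintro r ⟨pc, Z, I⟩ hd ⟨h1, h6, h9, h10, h11, h12, h13, h14, h15, h16, hle⟩ hpc
    dsimp only at *
    subst hpc
    by_cases hlt : p * q ^ 2 < (r + 1) ^ 2
    · have hn : ¬ (((r : ℝ) + 1) ^ 2 ≤ p * q ^ 2) := by rw [not_le]; exact_mod_cast hlt
      refine ⟨_, r, ⟨2, by norm_num, rfl⟩, ?_⟩
      have e : (step ∅ rootMachine)^[2] ⟨27, Z, I⟩ =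
          ⟨33, Function.update Z 7 (p * q ^ 2 - (r + 1) ^ 2), I⟩ := by
        simp [step, exec, rootMachine, h10, h13, hn]
      rw [e]
      exact ⟨by constructor <;> simpa, hlt, rfl⟩
    · have hn : (((r : ℝ) + 1) ^ 2 ≤ p * q ^ 2) := by
        rw [not_lt] at hlt; exact_mod_cast hlt
      have e : (step ∅ rootMachine)^[6] ⟨27, Z, I⟩ =
          ⟨27, Function.update (Function.update (Function.update (Function.update Z 7
            (p * q ^ 2 - (r + 1) ^ 2)) 12 (r + 1)) 13 ((r + 1) ^ 2 + (2 * r + 3))) 14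
            (2 * r + 3 + 2), I⟩ := by
        simp [step, exec, rootMachine, h10, h13, hn, h6, h12, h14, h16]
      obtain ⟨c', r', hR, h⟩ := ih (r + 1) _ (by omega) (by
        constructor
        case le => omega
        all_goals first | simpa | (simp; ring)) (rfl : Config.pc
          ⟨27, Function.update (Function.update (Function.update (Function.update Z 7
            (p * q ^ 2 - (r + 1) ^ 2)) 12 (r + 1)) 13 ((r + 1) ^ 2 + (2 * r + 3))) 14
            (2 * r + 3 + 2), I⟩ = 27)
      exact ⟨c', r', Reach.trans ⟨6, by norm_num, e⟩ hR, h⟩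

/-- One round of the approximation. -/
theorem approx_round {x : ℝ} {p q r : ℕ} {c : Config} (hc : Approx x p q r c) (hpc : c.pc = 24) :
    ∃ c' r', Reach c c' ∧ r' ^ 2 ≤ p * (q + 1) ^ 2 ∧ p * (q + 1) ^ 2 < (r' + 1) ^ 2 ∧
      if ((q + 1 : ℕ) : ℝ) * x < r' ∨ (r' + 1 : ℝ) < ((q + 1 : ℕ) : ℝ) * x
      then c'.pc = 40 ∧ c'.tuple = [1]
      else Approx x p (q + 1) r' c' ∧ c'.pc = 24 := by
  obtain ⟨pc, Z, I⟩ := c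
  obtain ⟨h1, h6, h9, h10, h11, h12, h13, h14, h15, h16, hle⟩ := hc
  dsimp only at *
  subst hpc
  have e : (step ∅ rootMachine)^[3] ⟨24, Z, I⟩ =
      ⟨27, Function.update (Function.update (Function.update Z 10
        (p * q ^ 2 + p * (2 * q + 1))) 11 (p * (2 * q + 1) + 2 * p)) 9 (q * x + x), I⟩ := by
    simp [step, exec, rootMachine, h10, h11, h9, h1, h15]
  obtain ⟨⟨pc, Z', I'⟩, r', hR, hS, hlt, hpc⟩ := approx_inner (x := x) (p := p) (q := q + 1) _ r
    ⟨27, Function.update (Function.update (Function.update Z 10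
        (p * q ^ 2 + p * (2 * q + 1))) 11 (p * (2 * q + 1) + 2 * p)) 9 (q * x + x), I⟩ rfl (by
        constructor
        case le => exact hle.trans (by gcongr; omega)
        all_goals first | simpa | (simp; ring)) rfl
  have hR := Reach.trans ⟨3, by norm_num, e⟩ hR
  clear e h1 h6 h9 h10 h11 h12 h13 h14 h15 h16 hle
  have hS' := hS
  obtain ⟨h1, h6, h9, h10, h11, h12, h13, h14, h15, h16, hle⟩ := hS
  dsimp only at *
  subst hpc
  by_cases ha : ((q + 1 : ℕ) : ℝ) * x < r'
  · have e : (step ∅ rootMachine)^[4] ⟨33, Z', I'⟩ =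
        ⟨40, Function.update (Function.update Z' 7 (((q + 1 : ℕ) : ℝ) * x - r')) 0 1,
          Function.update I' 0 1⟩ := by
      have ha' := not_le.2 ha
      simp [-Nat.cast_add, step, exec, rootMachine, h9, h12, ha']
    refine ⟨_, r', hR.trans ⟨4, by norm_num, e⟩, hle, hlt, ?_⟩
    rw [if_pos (Or.inl ha)]
    simp [Config.tuple]
  · by_cases hb : (r' + 1 : ℝ) < ((q + 1 : ℕ) : ℝ) * x
    · have e : (step ∅ rootMachine)^[7] ⟨33, Z', I'⟩ =
          ⟨40, Function.update (Function.update Z' 7 (r' + 1 - ((q + 1 : ℕ) : ℝ) * x)) 0 1,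
            Function.update I' 0 1⟩ := by
        have ha' := not_lt.1 ha
        have hb' := not_le.2 hb
        simp [-Nat.cast_add, step, exec, rootMachine, h9, h12, h6, ha', hb']
      refine ⟨_, r', hR.trans ⟨7, by norm_num, e⟩, hle, hlt, ?_⟩
      rw [if_pos (Or.inr hb)]
      simp [Config.tuple]
    · have e : (step ∅ rootMachine)^[5] ⟨33, Z', I'⟩ =
          ⟨24, Function.update Z' 7 (r' + 1 - ((q + 1 : ℕ) : ℝ) * x), I'⟩ := by
        have ha' := not_lt.1 ha
        have hb' := not_lt.1 hb
        simp [-Nat.cast_add, step, exec, rootMachine, h9, h12, h6, ha', hb']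
      refine ⟨_, r', hR.trans ⟨5, by norm_num, e⟩, hle, hlt, ?_⟩
      rw [if_neg (by tauto)]
      exact ⟨by constructor <;> simpa [-Nat.cast_add], rfl⟩

theorem approx_start {x j : ℝ} {p : ℕ} {c : Config} (hc : Search x j p c) (hpc : c.pc = 19) :
    ∃ c', Reach c c' ∧ Approx x p 0 0 c' ∧ c'.pc = 24 := by
  obtain ⟨pc, Z, I⟩ := c
  obtain ⟨h0, h1, h2, h6, h8, h9, h10, h12⟩ := hc
  dsimp only at *
  subst hpc
  have e : (step ∅ rootMachine)^[5] ⟨19, Z, I⟩ =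
      ⟨24, Function.update (Function.update (Function.update (Function.update (Function.update Z
        11 p) 15 (p + p)) 13 1) 16 2) 14 3, I⟩ := by
    simp [step, exec, rootMachine, h2, h6, h8]
    norm_num
  refine ⟨_, ⟨5, by norm_num, e⟩, ?_, rfl⟩
  constructor
  case le => simp
  all_goals first | simpa | (simp; done) | (simp; ring)

theorem init_ok (j x : ℝ) : ∃ c, Reach (init [j, x]) c ∧ Search x j 1 c ∧ c.pc = 5 := by
  have e : (step ∅ rootMachine)^[5] (init [j, x]) =
      ⟨5, Function.update (Function.update (init [j, x]).Z 6 1) 2 1,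
        Function.update (init [j, x]).I 1 2⟩ := by
    simp [step, exec, rootMachine, init]
  refine ⟨_, ⟨5, by norm_num, e⟩, ?_, rfl⟩
  constructor <;> simp [init]

theorem init_bad {z : List ℝ} (hz : z.length ≠ 2) : ¬ Halts ∅ rootMachine z := by
  have e : (step ∅ rootMachine)^[2] (init z) =
      ⟨2, (init z).Z, Function.update (init z).I 1 2⟩ := by
    simp [step, exec, rootMachine, init]
  refine not_halts_of_loop (fun c => c.pc = 2 ∧ c.I 0 ≠ c.I 1) (fun c h => by omega) ?_
    ⟨2, by norm_num, e⟩ ⟨rfl, by simpa [init] using hz⟩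
  rintro ⟨pc, Z, I⟩ ⟨h, h'⟩
  dsimp only at *
  subst h
  exact ⟨⟨2, Z, I⟩, ⟨1, by norm_num, by simp [step, exec, rootMachine, h']⟩, rfl, h'⟩

/-- There are machines `K ∈ M_add^1` that semi-decide `notRoot`. -/
theorem semiDecides_rootMachine : SemiDecides rootMachine notRoot := by
  intro z _
  by_cases hz : z.length = 2
  swap
  · refine ⟨?_, fun _ => init_bad hz⟩
    rintro ⟨i, _, x, _, rfl⟩
    simp at hz
  obtain ⟨j, x, rfl⟩ := List.length_eq_two.1 hz
  obtain ⟨c, hR, hS, hpc⟩ := init_ok j x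
  by_cases hj : ∃ i : ℕ, 1 ≤ i ∧ j = i
  swap
  · refine ⟨?_, fun _ => ?_⟩
    · rintro ⟨i, hi, x', _, h⟩
      simp only [List.cons.injEq] at h
      exact (hj ⟨i, hi, h.1⟩).elim
    · refine not_halts_of_loop (fun c => ∃ (j' : ℝ) (p : ℕ), 1 ≤ p ∧ Search x j' p c ∧ c.pc = 5 ∧
        ¬ ∃ i : ℕ, 1 ≤ i ∧ j' = i) (fun c ⟨_, _, _, _, h, _⟩ => by omega) ?_ hR
        ⟨j, 1, le_rfl, by simpa using hS, hpc, hj⟩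
      rintro c ⟨j', p, hp, hS, hpc, hj⟩
      obtain ⟨c', hR, ⟨_, hS, hpc'⟩ | ⟨_, hS, hpc'⟩⟩ := search_round hp hS hpc
      · exact ⟨c', hR, j', p + 1, by omega, hS, hpc', hj⟩
      · have h1 : j' ≠ 1 := fun h => hj ⟨1, le_rfl, by simp [h]⟩
        refine ⟨c', hR, j' - 1, p + 1, by omega, hS, by simpa [h1] using hpc', ?_⟩
        rintro ⟨i, hi, h⟩
        exact hj ⟨i + 1, by omega, by push_cast; linarith⟩
  obtain ⟨i, hi, rfl⟩ := hj
  have hcount : Nat.count Nat.Prime 2 = 0 := by decide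
  obtain ⟨c₁, hR₁, hS₁, hpc₁⟩ := search_prime (x := x) (k := i - 1) _ 1 i c le_rfl hi
    (by rw [hcount]; omega) rfl (by simpa using hS) hpc
  obtain ⟨c₂, hR₂, hS₂, hpc₂⟩ := approx_start hS₁ hpc₁
  have hR := (hR.trans hR₁).trans hR₂
  have hmem : [(i : ℝ), x] ∈ notRoot ↔ x ≠ rootPrime i := by
    constructor
    · rintro ⟨i', _, x', hx, h⟩
      simp only [List.cons.injEq, Nat.cast_inj, and_true] at h
      rw [h.1, h.2]; exact hx
    · exact fun h => ⟨i, hi, x, h, rfl⟩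
  rw [hmem]
  clear hmem hS hpc hR₁ hS₁ hpc₁ hR₂ c₁
  unfold rootPrime
  set p := Nat.nth Nat.Prime (i - 1)
  have bounds : ∀ q r : ℕ, r ^ 2 ≤ p * q ^ 2 → p * q ^ 2 < (r + 1) ^ 2 →
      (r : ℝ) ≤ q * √p ∧ q * √p < r + 1 := by
    intro q r h1 h2
    have hsq : ((q : ℝ) * √p) ^ 2 = p * q ^ 2 := by
      rw [mul_pow, Real.sq_sqrt (Nat.cast_nonneg p), mul_comm]
    constructor
    · refine le_of_sq_le_sq ?_ (by positivity)
      rw [hsq]; exact_mod_cast h1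
    · refine lt_of_pow_lt_pow_left₀ 2 (by positivity) ?_
      rw [hsq]; exact_mod_cast h2
  constructor
  · intro hx
    obtain ⟨N, hN⟩ := exists_nat_gt (1 / |x - √p|)
    have hpos : 0 < |x - √p| := abs_pos.2 (sub_ne_zero.2 hx)
    rw [div_lt_iff₀ hpos] at hN
    have main : ∀ d q r : ℕ, ∀ c, N - q = d → Approx x p q r c → c.pc = 24 →
        ∃ c', Reach c c' ∧ c'.pc = 40 ∧ c'.tuple = [1] := by
      intro d
      induction d with
      | zero =>
        intro q r c hd hA hpc
        obtain ⟨c', r', hR, h1, h2, h⟩ := approx_round hA hpc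
        obtain ⟨b1, b2⟩ := bounds _ _ h1 h2
        rw [if_pos] at h
        · exact ⟨c', hR, h⟩
        have hq : (N : ℝ) ≤ ((q + 1 : ℕ) : ℝ) := by exact_mod_cast (by omega : N ≤ q + 1)
        have hq := hN.trans_le (mul_le_mul_of_nonneg_right hq hpos.le)
        rcases lt_or_gt_of_ne hx with hx | hx
        · left
          rw [abs_of_neg (by linarith)] at hq
          nlinarith
        · right
          rw [abs_of_pos (by linarith)] at hq
          nlinarith
      | succ d ih =>
        intro q r c hd hA hpc
        obtain ⟨c', r', hR, h1, h2, h⟩ := approx_round hA hpc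
        split_ifs at h
        · exact ⟨c', hR, h⟩
        · obtain ⟨c'', hR', h'⟩ := ih (q + 1) r' c' (by omega) h.1 h.2
          exact ⟨c'', hR.trans hR', h'⟩
    obtain ⟨c', hR', h1, h2⟩ := main _ 0 0 c₂ rfl hS₂ hpc₂
    obtain ⟨t, _, rfl⟩ := hR.trans hR'
    exact ⟨t, by rw [h1]; rfl, h2⟩
  · intro hx
    rw [not_not] at hx
    refine not_halts_of_loop (fun c => ∃ q r : ℕ, Approx x p q r c ∧ c.pc = 24)
      (fun c ⟨_, _, _, h⟩ => by omega) ?_ hR ⟨0, 0, hS₂, hpc₂⟩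
    rintro c ⟨q, r, hA, hpc⟩
    obtain ⟨c', r', hR, h1, h2, h⟩ := approx_round hA hpc
    obtain ⟨b1, b2⟩ := bounds _ _ h1 h2
    rw [if_neg] at h
    · exact ⟨c', hR, q + 1, r', h⟩
    · rw [hx, not_or, not_lt, not_lt]
      exact ⟨b1, b2.le⟩

theorem isOrdMachine_rootMachine : IsOrdMachine rootMachine := by
  constructor
  · intro j l₁ l₂; simp [rootMachine]
  · intro l₁ l₂; simp [rootMachine]

end AddBSS

namespace AddBSS

/-! An additive machine with constants 0 and 1 that starts on integer affine forms `a y + b` in a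
single unknown `y` keeps such forms in all its real registers. At an irrational `y` a form vanishes
only if `a = b = 0`. Equality tests therefore have the same outcome at all irrational points, so
halting of an equality machine, and hence membership in `haltEq` of a tuple of forms, does not
depend on which irrational number is substituted (`IsEqMachine.halts_affine`,
`map_affine_mem_haltEq`). Order tests are decided near an irrational `x` by continuity, because a
form that is zero at `x` is zero identically. Consequently, every halting computation with the
oracle `haltEq` on forms at `x`, with integer output, is repeated with the same output at all
irrational `y` close to `x` (`Outputs.eventually_affine`).

Positive rational multiples of π are irrational and accumulate at √2 from below, which gives the
common answer on √2 and some `n/m * π`, and with it the undecidability of `{√2}`. The same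
perturbation applied to the tuple (2, 1, y, code K) shows that `haltLevel K 1` is not reducible to
`haltEq`: the tuple lies outside at y = √2 and inside at every other y.

Conversely, `haltLevel K 1` exceeds `haltEq` at most by tuples (2, 1, y, code K), and none of these
is in `haltEq` unless `K` is an equality machine. One oracle query followed by a comparison with
this fixed pattern therefore decides `haltEq` (`patternMachine`). -/

open Filter Topology

/-! ### Integer affine forms at irrational points -/

/-- The value at `y` of the affine form `a y + b` with integer coefficients `(a, b)`. -/
def affine (y : ℝ) (p : ℤ × ℤ) : ℝ := p.1 * y + p.2

@[simp] theorem affine_zero (y : ℝ) : affine y 0 = 0 := by simp [affine]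

@[simp] theorem affine_const (y : ℝ) (k : ℤ) : affine y (0, k) = k := by simp [affine]

@[simp] theorem affine_one (y : ℝ) : affine y (0, 1) = 1 := by simp [affine]

theorem affine_add (y : ℝ) (p q : ℤ × ℤ) : affine y (p + q) = affine y p + affine y q := by
  simp [affine]; ring

theorem affine_sub (y : ℝ) (p q : ℤ × ℤ) : affine y (p - q) = affine y p - affine y q := by
  simp [affine]; ring

/-- A form with nonzero slope takes an irrational value at an irrational point, so only a constant
form can take an integer value. -/
theorem affine_eq_intCast {y : ℝ} (hy : Irrational y) {p : ℤ × ℤ} {k : ℤ} :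
    affine y p = k ↔ p = (0, k) := by
  refine ⟨fun h => ?_, by rintro rfl; simp⟩
  obtain ⟨a, b⟩ := p
  by_cases ha : a = 0
  · subst ha
    simpa [affine] using h
  · exact ((((hy.intCast_mul ha).add_intCast b).ne_int k) h).elim

theorem affine_eq_zero {y : ℝ} (hy : Irrational y) {p : ℤ × ℤ} : affine y p = 0 ↔ p = 0 := by
  have := affine_eq_intCast hy (p := p) (k := 0)
  rwa [Int.cast_zero] at this

/-! ### Symbolic execution on affine forms -/

/-- A configuration whose real registers contain affine forms in one variable. -/
structure SymConfig where
  pc : ℕ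
  Z : ℕ → ℤ × ℤ
  I : ℕ → ℕ

/-- The configuration obtained by evaluating the affine forms at `y`. -/
def SymConfig.eval (s : SymConfig) (y : ℝ) : Config := ⟨s.pc, fun i => affine y (s.Z i), s.I⟩

theorem SymConfig.tuple_eval (s : SymConfig) (y : ℝ) :
    (s.eval y).tuple = ((List.range (s.I 0)).map s.Z).map (affine y) := by
  simp [Config.tuple, SymConfig.eval]

theorem affine_comp_update (y : ℝ) (Z : ℕ → ℤ × ℤ) (i : ℕ) (p : ℤ × ℤ) :
    (fun k => affine y (Function.update Z i p k)) =
      Function.update (fun k => affine y (Z k)) i (affine y p) := by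
  ext k
  by_cases h : k = i
  · subst h; simp
  · simp [h]

/-- The initial configuration for an input that consists of affine forms. -/
def symInit (l : List (ℤ × ℤ)) : SymConfig := ⟨0, fun i => l.getD i 0, fun _ => l.length⟩

theorem symInit_eval (l : List (ℤ × ℤ)) (y : ℝ) :
    (symInit l).eval y = init (l.map (affine y)) := by
  simp only [symInit, SymConfig.eval, init, List.length_map, Config.mk.injEq, true_and, and_true]
  ext i
  rw [← affine_zero y, List.getD_map]

/-- The truth value of `P` is eventually constant along `F`. -/
def Settled (F : Filter ℝ) (P : ℝ → Prop) : Prop := (∀ᶠ y in F, P y) ∨ ∀ᶠ y in F, ¬ P y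

theorem Settled.exists_ite {F : Filter ℝ} {P : ℝ → Prop} [∀ y, Decidable (P y)]
    (h : Settled F P) (l₁ l₂ : ℕ) : ∃ l, ∀ᶠ y in F, (if P y then l₁ else l₂) = l := by
  rcases h with h | h
  · exact ⟨l₁, h.mono fun y hy => if_pos hy⟩
  · exact ⟨l₂, h.mono fun y hy => if_neg hy⟩

theorem settled_eq_zero {F : Filter ℝ} (hF : ∀ᶠ y in F, Irrational y) (p : ℤ × ℤ) :
    Settled F fun y => affine y p = 0 := by
  by_cases hp : p = 0
  · exact .inl (hF.mono fun y hy => (affine_eq_zero hy).2 hp)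
  · exact .inr (hF.mono fun y hy h => hp ((affine_eq_zero hy).1 h))

/-- Assignments act on the forms themselves, and every test is settled along `F`, so one symbolic
successor serves for almost all `y`. The filter is left general: the principal filter of the
irrationals suits equality machines, irrational neighbourhoods suit order tests and queries. -/
theorem exists_symConfig_step {F : Filter ℝ} (hF : ∀ᶠ y in F, Irrational y)
    {O : Set (List ℝ)} {M : Machine}
    (hge : ∀ j l₁ l₂, Instr.ifGe j l₁ l₂ ∈ M → ∀ p, Settled F fun y => affine y p ≥ 0)
    (hquery : ∀ l₁ l₂, Instr.query l₁ l₂ ∈ M →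
      ∀ l : List (ℤ × ℤ), Settled F fun y => l.map (affine y) ∈ O)
    (s : SymConfig) : ∃ s' : SymConfig, ∀ᶠ y in F, step O M (s.eval y) = s'.eval y := by
  classical
  have hpc : ∀ y, (s.eval y).pc = s.pc := fun _ => rfl
  unfold step
  simp only [hpc]
  rcases hM : M[s.pc]? with _ | a
  · exact ⟨s, by simp⟩
  have ha := List.mem_of_getElem? hM
  cases a with
  | add i j k =>
    refine ⟨⟨s.pc + 1, Function.update s.Z i (s.Z j + s.Z k), s.I⟩, .of_forall fun y => ?_⟩
    simp [exec, SymConfig.eval, affine_comp_update, affine_add]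
  | sub i j k =>
    refine ⟨⟨s.pc + 1, Function.update s.Z i (s.Z j - s.Z k), s.I⟩, .of_forall fun y => ?_⟩
    simp [exec, SymConfig.eval, affine_comp_update, affine_sub]
  | setZero i =>
    refine ⟨⟨s.pc + 1, Function.update s.Z i 0, s.I⟩, .of_forall fun y => ?_⟩
    simp [exec, SymConfig.eval, affine_comp_update]
  | setOne i =>
    refine ⟨⟨s.pc + 1, Function.update s.Z i (0, 1), s.I⟩, .of_forall fun y => ?_⟩
    simp [exec, SymConfig.eval, affine_comp_update]
  | ifEq j l₁ l₂ =>
    obtain ⟨l, hl⟩ := (settled_eq_zero hF (s.Z j)).exists_ite l₁ l₂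
    refine ⟨⟨l, s.Z, s.I⟩, hl.mono fun y hy => ?_⟩
    simp only [exec, SymConfig.eval, ← hy]
    congr
  | ifGe j l₁ l₂ =>
    obtain ⟨l, hl⟩ := (hge j l₁ l₂ ha (s.Z j)).exists_ite l₁ l₂
    exact ⟨⟨l, s.Z, s.I⟩, hl.mono fun y hy => by simpa [exec, SymConfig.eval] using hy⟩
  | copy j k =>
    refine ⟨⟨s.pc + 1, Function.update s.Z (s.I j - 1) (s.Z (s.I k - 1)), s.I⟩,
      .of_forall fun y => ?_⟩
    simp [exec, SymConfig.eval, affine_comp_update]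
  | idxOne j => exact ⟨⟨s.pc + 1, s.Z, Function.update s.I j 1⟩, .of_forall fun y => rfl⟩
  | idxSucc j =>
    exact ⟨⟨s.pc + 1, s.Z, Function.update s.I j (s.I j + 1)⟩, .of_forall fun y => rfl⟩
  | ifIdx j k l₁ l₂ =>
    exact ⟨⟨if s.I j = s.I k then l₁ else l₂, s.Z, s.I⟩, .of_forall fun y => rfl⟩
  | query l₁ l₂ =>
    obtain ⟨l, hl⟩ := (hquery l₁ l₂ ha ((List.range (s.I 0)).map s.Z)).exists_ite l₁ l₂
    refine ⟨⟨l, s.Z, s.I⟩, hl.mono fun y hy => ?_⟩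
    simp only [exec, SymConfig.tuple_eval, hy]
    rfl

/-- For a fixed number of steps only finitely many eventual conditions are intersected. The set of
good `y` may shrink as `t` grows. -/
theorem exists_symConfig_iterate {F : Filter ℝ} {O : Set (List ℝ)} {M : Machine}
    (h : ∀ s : SymConfig, ∃ s' : SymConfig, ∀ᶠ y in F, step O M (s.eval y) = s'.eval y)
    (s : SymConfig) (t : ℕ) :
    ∃ s' : SymConfig, ∀ᶠ y in F, (step O M)^[t] (s.eval y) = s'.eval y := by
  induction t with
  | zero => exact ⟨s, by simp⟩
  | succ t ih =>
    obtain ⟨s', hs'⟩ := ih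
    obtain ⟨s'', hs''⟩ := h s'
    refine ⟨s'', ?_⟩
    filter_upwards [hs', hs''] with y h1 h2
    rw [Function.iterate_succ_apply', h1, h2]

/-- Machines with equality tests do not distinguish irrational numbers. -/
theorem IsEqMachine.halts_affine {N : Machine} (hN : IsEqMachine N) {x y : ℝ}
    (hx : Irrational x) (hy : Irrational y) {l : List (ℤ × ℤ)}
    (h : Halts ∅ N (l.map (affine x))) : Halts ∅ N (l.map (affine y)) := by
  obtain ⟨t, ht⟩ := h
  -- Along this principal filter, "eventually" means "at every irrational point", so no closeness of
  -- `x` and `y` is needed.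
  have hF : ∀ᶠ y in 𝓟 {y : ℝ | Irrational y}, Irrational y := eventually_principal.2 fun _ h => h
  obtain ⟨s, hs⟩ := exists_symConfig_iterate (exists_symConfig_step hF (O := ∅) (M := N)
    (fun j l₁ l₂ h => (hN.1 j l₁ l₂ h).elim) (fun l₁ l₂ h => (hN.2 l₁ l₂ h).elim)) (symInit l) t
  rw [eventually_principal] at hs
  refine ⟨t, ?_⟩
  rw [← symInit_eval] at ht ⊢
  rw [hs x hx] at ht
  rw [hs y hy]
  exact ht

/-! ### The oracle `haltEq` on tuples of affine forms -/

/-- The entries are only 0 and 1. The bound 2 is the one needed later, where entries are compared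
with registers containing 0, 1 and 2. -/
theorem exists_code_eq_map_natCast (M : Machine) :
    ∃ k : List ℕ, code M = k.map (Nat.cast : ℕ → ℝ) ∧ ∀ i ∈ k, i ≤ 2 := by
  have h : ∀ v ∈ code M, v = 0 ∨ v = 1 := by
    intro v hv
    obtain ⟨s, -, hs⟩ := List.mem_flatMap.1 hv
    cases s <;> simp [Symb.bits] at hs <;> tauto
  generalize code M = u at h
  induction u with
  | nil => exact ⟨[], by simp⟩
  | cons v u ih =>
    obtain ⟨k, hk, hk'⟩ := ih fun v hv => h v (by simp [hv])
    rcases h v (by simp) with rfl | rfl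
    · exact ⟨0 :: k, by simp [hk], by simpa using hk'⟩
    · exact ⟨1 :: k, by simp [hk], by simpa using hk'⟩

theorem exists_code_eq_map_intCast (M : Machine) :
    ∃ k : List ℤ, code M = k.map (Int.cast : ℤ → ℝ) := by
  obtain ⟨k, hk, -⟩ := exists_code_eq_map_natCast M
  exact ⟨k.map Nat.cast, by simp [hk]⟩

theorem map_affine_const (y : ℝ) (k : List ℤ) :
    (k.map fun i => ((0, i) : ℤ × ℤ)).map (affine y) = k.map (Int.cast : ℤ → ℝ) := by
  simp [Function.comp_def]

theorem map_affine_eq_map_intCast {y : ℝ} (hy : Irrational y) {l : List (ℤ × ℤ)} {k : List ℤ} :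
    l.map (affine y) = k.map (Int.cast : ℤ → ℝ) ↔ l = k.map fun i => ((0, i) : ℤ × ℤ) := by
  refine ⟨fun h => ?_, fun h => h ▸ map_affine_const y k⟩
  induction l generalizing k with
  | nil =>
    cases k with
    | nil => rfl
    | cons i k => simp at h
  | cons p l ih =>
    cases k with
    | nil => simp at h
    | cons i k =>
      simp only [List.map_cons, List.cons.injEq] at h ⊢
      exact ⟨(affine_eq_intCast hy).1 h.1, ih h.2⟩

/-- The length entry and the code are integers at `x`, so their forms are constant. Passing to `y`
thus keeps the machine `N` and the length of its input and changes only the input, where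
`IsEqMachine.halts_affine` applies. -/
theorem map_affine_mem_haltEq {x y : ℝ} (hx : Irrational x) (hy : Irrational y)
    {l : List (ℤ × ℤ)} (h : l.map (affine x) ∈ haltEq) : l.map (affine y) ∈ haltEq := by
  obtain ⟨u, N, hu, hN, hH, h⟩ := h
  obtain ⟨p, l', rfl, hp, h⟩ := List.map_eq_cons_iff.1 h
  obtain ⟨l₁, l₂, rfl, rfl, h₂⟩ := List.map_eq_append_iff.1 h
  obtain ⟨k, hk⟩ := exists_code_eq_map_intCast N
  rw [hk, map_affine_eq_map_intCast hx] at h₂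
  have hp' : p = (0, (l₁.length : ℤ)) := by
    rw [← affine_eq_intCast hx, hp]; simp
  refine ⟨l₁.map (affine y), N, by simpa using hu, hN, hN.halts_affine hx hy hH, ?_⟩
  rw [List.map_cons, List.map_append, h₂, map_affine_const, ← hk, hp']
  simp

theorem settled_haltEq {F : Filter ℝ} (hF : ∀ᶠ y in F, Irrational y) {x : ℝ} (hx : Irrational x)
    (l : List (ℤ × ℤ)) : Settled F fun y => l.map (affine y) ∈ haltEq := by
  by_cases h : l.map (affine x) ∈ haltEq
  · exact .inl (hF.mono fun y hy => map_affine_mem_haltEq hx hy h)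
  · exact .inr (hF.mono fun y hy h' => h (map_affine_mem_haltEq hy hx h'))

/-! ### Stability of computations near an irrational input -/

/-- A nonzero value at `x` keeps its sign nearby by continuity. A zero value forces the zero form,
for which the test succeeds everywhere. -/
theorem settled_nonneg {x : ℝ} (hx : Irrational x) (p : ℤ × ℤ) :
    Settled (𝓝[{y | Irrational y}] x) fun y => affine y p ≥ 0 := by
  have hc : Tendsto (fun y => affine y p) (𝓝[{y | Irrational y}] x) (𝓝 (affine x p)) := by
    refine (Continuous.tendsto ?_ x).mono_left nhdsWithin_le_nhds
    unfold affine
    fun_prop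
  rcases lt_trichotomy (affine x p) 0 with h | h | h
  · exact .inr ((hc.eventually_lt_const h).mono fun y hy => not_le.2 hy)
  · rw [affine_eq_zero hx] at h
    subst h
    exact .inl (.of_forall fun y => by simp)
  · exact .inl ((hc.eventually_const_lt h).mono fun y hy => hy.le)

/-- An output of one integer is stable under small irrational perturbations of the input. -/
theorem Outputs.eventually_affine {M : Machine} {x : ℝ}
    (hx : Irrational x) {l : List (ℤ × ℤ)} {k : List ℤ}
    (h : Outputs haltEq M (l.map (affine x)) (k.map Int.cast)) :
    ∀ᶠ y in 𝓝[{y | Irrational y}] x, Outputs haltEq M (l.map (affine y)) (k.map Int.cast) := by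
  obtain ⟨t, ht, hk⟩ := h
  have hF : ∀ᶠ y in 𝓝[{y | Irrational y}] x, Irrational y := eventually_mem_nhdsWithin
  obtain ⟨s, hs⟩ := exists_symConfig_iterate (exists_symConfig_step hF (O := haltEq) (M := M)
    (fun _ _ _ _ => settled_nonneg hx) (fun _ _ _ => settled_haltEq hF hx)) (symInit l) t
  -- Since `x` is itself irrational, the symbolic configuration also describes the computation on
  -- `x`.
  have hsx := hs.self_of_nhdsWithin hx
  rw [← symInit_eval, hsx] at ht hk
  -- The integer output at `x` comes from constant forms, hence the output is the same at nearby
  -- points.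
  rw [SymConfig.tuple_eval, map_affine_eq_map_intCast hx] at hk
  filter_upwards [hs] with y hy
  refine ⟨t, ?_⟩
  rw [← symInit_eval, hy, SymConfig.tuple_eval, hk, map_affine_const]
  exact ⟨ht, rfl⟩

theorem Accepts.eventually_affine {M : Machine} {x : ℝ}
    (hx : Irrational x) {l : List (ℤ × ℤ)} (h : Accepts haltEq M (l.map (affine x))) :
    ∀ᶠ y in 𝓝[{y | Irrational y}] x, Accepts haltEq M (l.map (affine y)) := by
  have := Outputs.eventually_affine hx (l := l) (k := [1]) (by simpa [Accepts] using h)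
  simpa [Accepts] using this

theorem Rejects.eventually_affine {M : Machine} {x : ℝ}
    (hx : Irrational x) {l : List (ℤ × ℤ)} (h : Rejects haltEq M (l.map (affine x))) :
    ∀ᶠ y in 𝓝[{y | Irrational y}] x, Rejects haltEq M (l.map (affine y)) := by
  have := Outputs.eventually_affine hx (l := l) (k := [0]) (by simpa [Rejects] using h)
  simpa [Rejects] using this

/-! ### Rational multiples of π near √2 -/

/-- Density of the rationals, scaled by π. The strict inequality ensures that the point found
differs from `x`. -/
theorem exists_rat_mul_pi {x : ℝ} (hx : 0 < x) {P : ℝ → Prop}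
    (h : ∀ᶠ y in 𝓝[{y | Irrational y}] x, P y) :
    ∃ n m : ℕ, 0 < n ∧ 0 < m ∧ (n : ℝ) / m * Real.pi < x ∧ P ((n : ℝ) / m * Real.pi) := by
  rw [eventually_nhdsWithin_iff, Metric.eventually_nhds_iff] at h
  obtain ⟨ε, hε, h⟩ := h
  -- The maximum with 0 makes `q` positive, so that its numerator can be taken as a natural number.
  obtain ⟨q, hq1, hq2⟩ := exists_rat_btwn (show max 0 ((x - ε) / Real.pi) < x / Real.pi from
    max_lt (div_pos hx Real.pi_pos) (div_lt_div_of_pos_right (by linarith) Real.pi_pos))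
  rw [max_lt_iff, div_lt_iff₀ Real.pi_pos] at hq1
  rw [lt_div_iff₀ Real.pi_pos] at hq2
  have hq0 : 0 < q := by exact_mod_cast hq1.1
  have hn : (q.num.toNat : ℤ) = q.num := Int.toNat_of_nonneg (Rat.num_nonneg.2 hq0.le)
  have hq : ((q.num.toNat : ℕ) : ℝ) / (q.den : ℕ) = q := by
    rw [Rat.cast_def q, ← Int.cast_natCast (R := ℝ) q.num.toNat, hn]
  refine ⟨q.num.toNat, q.den, ?_, q.den_pos, ?_⟩
  · have := Rat.num_pos.2 hq0
    omega
  · rw [hq]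
    refine ⟨hq2, h ?_ (irrational_pi.ratCast_mul hq0.ne')⟩
    rw [Real.dist_eq, abs_lt]
    constructor <;> linarith

/-- Final configurations are fixed by `step`, so any two halting times give the same configuration.
-/
theorem Outputs.unique {O : Set (List ℝ)} {M : Machine} {x y z : List ℝ}
    (hy : Outputs O M x y) (hz : Outputs O M x z) : y = z := by
  have fix : ∀ (c : Config), M.length ≤ c.pc → ∀ k, (step O M)^[k] c = c := fun c hc k =>
    Function.iterate_fixed (by rw [step, List.getElem?_eq_none hc]) k
  obtain ⟨s, hs, rfl⟩ := hy
  obtain ⟨t, ht, rfl⟩ := hz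
  rcases le_total s t with h | h
  · obtain ⟨k, rfl⟩ := Nat.exists_eq_add_of_le' h
    rw [Function.iterate_add_apply, fix _ hs]
  · obtain ⟨k, rfl⟩ := Nat.exists_eq_add_of_le' h
    rw [Function.iterate_add_apply, fix _ ht]

theorem not_accepts_and_rejects {O : Set (List ℝ)} {M : Machine} {x : List ℝ}
    (h : Accepts O M x) (h' : Rejects O M x) : False := by
  simpa using Outputs.unique h h'

theorem exists_rat_mul_pi_agree {M : Machine} {S : Set ℝ}
    (hS : Decides haltEq M (asProblem S)) :
    ∃ n m : ℕ, 0 < n ∧ 0 < m ∧ (n : ℝ) / m * Real.pi < √2 ∧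
      ((Rejects haltEq M [√2] ∧ Rejects haltEq M [(n : ℝ) / m * Real.pi]) ∨
        (Accepts haltEq M [√2] ∧ Accepts haltEq M [(n : ℝ) / m * Real.pi])) := by
  have key : ∀ y : ℝ, [((1, 0) : ℤ × ℤ)].map (affine y) = [y] := by simp [affine]
  by_cases h : [√2] ∈ asProblem S
  · have h := (hS [√2] (by simp)).1 h
    rw [← key] at h
    obtain ⟨n, m, hn, hm, hlt, h'⟩ :=
      exists_rat_mul_pi (by positivity) (h.eventually_affine irrational_sqrt_two)
    rw [key] at h h'
    exact ⟨n, m, hn, hm, hlt, .inr ⟨h, h'⟩⟩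
  · have h := (hS [√2] (by simp)).2 h
    rw [← key] at h
    obtain ⟨n, m, hn, hm, hlt, h'⟩ :=
      exists_rat_mul_pi (by positivity) (h.eventually_affine irrational_sqrt_two)
    rw [key] at h h'
    exact ⟨n, m, hn, hm, hlt, .inl ⟨h, h'⟩⟩

theorem not_reducible_singleton_sqrt_two : ¬ Reducible (asProblem {√2}) haltEq := by
  rintro ⟨M, -, hS⟩
  obtain ⟨n, m, -, -, hlt, ⟨h, -⟩ | ⟨-, h⟩⟩ := exists_rat_mul_pi_agree hS
  · exact not_accepts_and_rejects ((hS _ (by simp)).1 ⟨√2, rfl, rfl⟩) h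
  · refine not_accepts_and_rejects h ((hS _ (by simp)).2 ?_)
    rintro ⟨x, rfl, hx⟩
    simp only [List.cons.injEq, and_true] at hx
    exact hlt.ne hx

/-! ### The first level is not reducible to `haltEq` -/

theorem rootPrime_one : rootPrime 1 = √2 := by
  have : Nat.nth Nat.Prime 0 = 2 := by
    have := Nat.nth_count Nat.prime_two
    rwa [show Nat.count Nat.Prime 2 = 0 by decide] at this
  simp [rootPrime, this]

theorem haltLevel_one (K : Machine) : haltLevel K 1 = haltEq ∪ haltRoot K 1 := by
  simp [haltLevel]

/-- The leading 2 fixes where the input ends, and `code_injective` then identifies the machine. -/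
theorem cons_cons_cons_code_mem_haltEq {K : Machine} {x : ℝ} :
    (2 : ℝ) :: ([1, x] ++ code K) ∈ haltEq ↔ IsEqMachine K ∧ Halts ∅ K [1, x] := by
  constructor
  · rintro ⟨u, N, -, hN, hH, h⟩
    simp only [List.cons.injEq] at h
    have hu : u.length = 2 := by exact_mod_cast h.1.symm
    obtain ⟨rfl, hK⟩ := List.append_inj h.2 (by simp [hu])
    rw [code_injective hK]
    exact ⟨hN, hH⟩
  · rintro ⟨hK, hH⟩
    exact ⟨[1, x], K, by simp, hK, hH, by simp⟩

theorem not_reducible_haltLevel_one {K : Machine} (hK : SemiDecides K notRoot) :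
    ¬ Reducible (haltLevel K 1) haltEq := by
  rintro ⟨M, -, hS⟩
  obtain ⟨k, hk⟩ := exists_code_eq_map_intCast K
  -- Only the form `(1, 0)` depends on `y`; all other entries are constants.
  set l : List (ℤ × ℤ) := (0, 2) :: ([(0, 1), (1, 0)] ++ k.map fun i => (0, i))
  have key : ∀ y, l.map (affine y) = (2 : ℝ) :: ([1, y] ++ code K) := by
    intro y
    rw [List.map_cons, List.map_append, map_affine_const, hk]
    simp [affine]
  have hrej : Rejects haltEq M (l.map (affine √2)) := by
    rw [key]
    refine (hS _ (by simp)).2 ?_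
    rw [haltLevel_one]
    -- Membership in `haltEq` would make `K` halt on (1, √2), outside `notRoot`; membership in
    -- `haltRoot K 1` would need √2 ≠ √2.
    rintro (h | ⟨x, hx, h⟩)
    · refine (hK [1, √2] (by simp)).2 ?_ (cons_cons_cons_code_mem_haltEq.1 h).2
      rintro ⟨i, hi, x, hx, h⟩
      simp only [List.cons.injEq, and_true] at h
      obtain ⟨h1, rfl⟩ := h
      rw [show i = 1 by exact_mod_cast h1.symm, rootPrime_one] at hx
      exact hx rfl
    · simp at h
      rw [rootPrime_one] at hx
      exact hx h.symm
  obtain ⟨n, m, -, -, hlt, h⟩ :=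
    exists_rat_mul_pi (by positivity) (hrej.eventually_affine irrational_sqrt_two)
  rw [key] at h
  refine not_accepts_and_rejects ((hS _ (by simp)).1 ?_) h
  rw [haltLevel_one]
  exact .inr ⟨_, by rw [rootPrime_one]; exact hlt.ne, by simp⟩


/-! ### A machine that removes a fixed pattern from its oracle -/

/-- `c'` is reached from `c` by `M` with the oracle `O`. -/
def Reaches (O : Set (List ℝ)) (M : Machine) (c c' : Config) : Prop :=
  ∃ t, (step O M)^[t] c = c'

section Reaches

variable {O : Set (List ℝ)} {M : Machine} {c c' c'' : Config}

theorem Reaches.refl : Reaches O M c c := ⟨0, rfl⟩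

theorem Reaches.trans (h : Reaches O M c c') (h' : Reaches O M c' c'') : Reaches O M c c'' := by
  obtain ⟨s, rfl⟩ := h
  obtain ⟨t, rfl⟩ := h'
  exact ⟨t + s, Function.iterate_add_apply _ _ _ _⟩

theorem Reaches.single {a : Instr} (h : M[c.pc]? = some a) : Reaches O M c (exec O c a) :=
  ⟨1, by simp [step, h]⟩

theorem Reaches.outputs {x : List ℝ} (h : Reaches O M (init x) c) (hc : M.length ≤ c.pc) :
    Outputs O M x c.tuple := by
  obtain ⟨t, rfl⟩ := h
  exact ⟨t, hc, rfl⟩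

end Reaches

/-- The register `I_1` starts with the length of the input, so a query made at the very start asks
about the input itself. -/
theorem init_tuple (x : List ℝ) : (init x).tuple = x := by
  refine List.ext_getElem (by simp [Config.tuple, init]) fun i h₁ h₂ => ?_
  simp [Config.tuple, init, h₂]

/-- Instructions, to be placed at the label `p`, that compare the contents of `Z_{i+1}` and
`Z_{m+k+1}` for each `(i, k)` in the list and go to the label `4` if there is a difference.
The register `Z_{m+1}` has to contain `0`. -/
def compareInstrs (m : ℕ) : ℕ → List (ℕ × ℕ) → Machine
  | _, [] => []
  | p, (i, k) :: w => .sub (m + 3) i (m + k) :: .ifGe (m + 3) (p + 2) 4 ::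
      .sub (m + 3) m (m + 3) :: .ifGe (m + 3) (p + 4) 4 :: compareInstrs m (p + 4) w

theorem length_compareInstrs (m p : ℕ) (w : List (ℕ × ℕ)) :
    (compareInstrs m p w).length = 4 * w.length := by
  induction w generalizing p with
  | nil => rfl
  | cons q w ih => simp [compareInstrs, ih]; ring

theorem getElem?_of_drop_eq {M u v : Machine} {p j : ℕ} {a : Instr} (h : M.drop p = u ++ v)
    (ha : u[j]? = some a) : M[p + j]? = some a := by
  rw [← List.getElem?_drop, h]
  exact List.getElem?_append_left (List.getElem?_eq_some_iff.1 ha).1 ▸ ha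

-- With order tests only, equality is checked by testing both the difference and its negative for
-- being nonnegative. Only the scratch register of index `m + 3` is overwritten, so the inputs below
-- `m` and the constants 0, 1, 2 at `m`, `m + 1`, `m + 2` survive for the next comparison.
open Classical in
theorem reaches_compareInstrs (O : Set (List ℝ)) {M : Machine} {m : ℕ} (z : ℕ → ℝ)
    (w : List (ℕ × ℕ)) (hw : ∀ q ∈ w, q.1 < m ∧ q.2 ≤ 2) (rest : Machine) {c₀ c : Config}
    (h₀ : Reaches O M c₀ c) (hM : M.drop c.pc = compareInstrs m c.pc w ++ rest)
    (hz : ∀ i < m, c.Z i = z i) (hk : ∀ k ≤ 2, c.Z (m + k) = k) :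
    ∃ c', Reaches O M c₀ c' ∧
      c'.pc = if ∀ q ∈ w, z q.1 = q.2 then c.pc + 4 * w.length else 4 := by
  induction w generalizing c with
  | nil => exact ⟨c, h₀, by simp⟩
  | cons q w ih =>
    obtain ⟨i, k⟩ := q
    obtain ⟨pc, Z, I⟩ := c
    dsimp only at *
    obtain ⟨hi, hk2⟩ := hw (i, k) (by simp)
    dsimp only at hi hk2
    have g : ∀ j a, (compareInstrs m pc ((i, k) :: w))[j]? = some a → M[pc + j]? = some a :=
      fun j a => getElem?_of_drop_eq hM
    have h0 := hk 0 (by omega)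
    simp only [add_zero, Nat.cast_zero] at h0
    have r1 : Reaches O M c₀ ⟨pc + 1, Function.update Z (m + 3) (z i - k), I⟩ := by
      have := h₀.trans (Reaches.single (g 0 _ rfl))
      simpa [exec, hz i hi, hk k hk2] using this
    have r2 := r1.trans (Reaches.single (g 1 _ rfl))
    simp only [exec, Function.update_self] at r2
    by_cases h1 : z i - k ≥ 0
    swap
    · rw [if_neg h1] at r2
      refine ⟨_, r2, ?_⟩
      rw [if_neg]
      intro h
      have := h (i, k) (by simp)
      dsimp only at this
      exact h1 (by rw [this]; simp)
    rw [if_pos h1] at r2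
    have r3 := r2.trans (Reaches.single (g 2 _ rfl))
    simp only [exec, Function.update_self, Function.update_idem] at r3
    rw [Function.update_of_ne (by omega), h0] at r3
    have r4 := r3.trans (Reaches.single (g 3 _ rfl))
    simp only [exec, Function.update_self] at r4
    by_cases h2 : 0 - (z i - k) ≥ 0
    swap
    · rw [if_neg h2] at r4
      refine ⟨_, r4, ?_⟩
      rw [if_neg]
      intro h
      have := h (i, k) (by simp)
      dsimp only at this
      exact h2 (by rw [this]; simp)
    rw [if_pos h2] at r4
    have hik : z i = k := by linarith
    obtain ⟨c', hR, hc'⟩ := ih (fun q hq => hw q (by simp [hq])) r4 (by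
        dsimp only
        rw [← List.drop_drop, hM]
        simp [compareInstrs]) (by
        intro j hj
        dsimp only
        rw [Function.update_of_ne (by omega), hz j hj]) (by
        intro j hj
        dsimp only
        rw [Function.update_of_ne (by omega), hk j hj])
    refine ⟨c', hR, ?_⟩
    rw [hc']
    simp only [List.forall_mem_cons, hik, true_and, List.length_cons]
    congr 1
    ring

theorem reaches_replicate_idxSucc (O : Set (List ℝ)) {M : Machine} {Z : ℕ → ℝ} {rest : Machine}
    (d p : ℕ) (I : ℕ → ℕ) (hM : M.drop p = List.replicate d (.idxSucc 1) ++ rest) :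
    Reaches O M ⟨p, Z, I⟩ ⟨p + d, Z, Function.update I 1 (I 1 + d)⟩ := by
  induction d generalizing p I with
  | zero => simpa using Reaches.refl
  | succ d ih =>
    have h1 := Reaches.single (O := O) (c := ⟨p, Z, I⟩) (getElem?_of_drop_eq (j := 0) hM rfl)
    have h2 := ih (p + 1) (Function.update I 1 (I 1 + 1)) (by
      rw [← List.drop_drop, hM]; simp [List.replicate_succ])
    refine h1.trans ?_
    simp only [exec, Function.update_self, Function.update_idem] at h2 ⊢
    rw [show p + (d + 1) = p + 1 + d by ring, show I 1 + (d + 1) = I 1 + 1 + d by ring]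
    exact h2

/-- A machine that decides which elements `z` of the oracle do not satisfy the conditions that
the length of `z` is `d + 1` and that `z i = k` for each pair `(i, k)` in `w`. The instructions
from label `1` on reject, those from label `4` on accept. -/
def patternMachine (d : ℕ) (w : List (ℕ × ℕ)) : Machine :=
  [.query 7 1, .idxOne 0, .setZero 0, .ifIdx 0 0 (d + 12 + 4 * w.length) (d + 12 + 4 * w.length),
    .idxOne 0, .setOne 0, .ifIdx 0 0 (d + 12 + 4 * w.length) (d + 12 + 4 * w.length),
    .idxOne 1] ++
  (List.replicate d (.idxSucc 1) ++
  ([.ifIdx 0 1 (d + 9) 4, .setOne (d + 2), .add (d + 3) (d + 2) (d + 2)] ++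
  (compareInstrs (d + 1) (d + 11) w ++ [.ifIdx 0 0 1 1])))

theorem length_patternMachine (d : ℕ) (w : List (ℕ × ℕ)) :
    (patternMachine d w).length = d + 12 + 4 * w.length := by
  simp only [patternMachine, List.length_append, List.length_replicate, length_compareInstrs,
    List.length_cons, List.length_nil]
  ring

theorem isOrdOracleMachine_patternMachine (d : ℕ) (w : List (ℕ × ℕ)) :
    IsOrdOracleMachine (patternMachine d w) := by
  intro j l₁ l₂
  have : ∀ m p, Instr.ifEq j l₁ l₂ ∉ compareInstrs m p w := by
    intro m p
    induction w generalizing p with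
    | nil => simp [compareInstrs]
    | cons q w ih => simp [compareInstrs, ih]
  simp [patternMachine, this]

theorem rejects_patternMachine_of_reaches {O : Set (List ℝ)} {d : ℕ} {w : List (ℕ × ℕ)}
    {x : List ℝ} {c : Config} (h : Reaches O (patternMachine d w) (init x) c) (hc : c.pc = 1) :
    Rejects O (patternMachine d w) x := by
  obtain ⟨pc, Z, I⟩ := c
  subst hc
  have r := ((h.trans (.single (a := .idxOne 0) rfl)).trans
    (.single (a := .setZero 0) rfl)).trans (.single (a := .ifIdx 0 0 _ _) rfl)
  simpa [Rejects, Accepts, exec, Config.tuple] using r.outputs (by simp [exec, length_patternMachine])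

theorem accepts_patternMachine_of_reaches {O : Set (List ℝ)} {d : ℕ} {w : List (ℕ × ℕ)}
    {x : List ℝ} {c : Config} (h : Reaches O (patternMachine d w) (init x) c) (hc : c.pc = 4) :
    Accepts O (patternMachine d w) x := by
  obtain ⟨pc, Z, I⟩ := c
  subst hc
  have r := ((h.trans (.single (a := .idxOne 0) rfl)).trans
    (.single (a := .setOne 0) rfl)).trans (.single (a := .ifIdx 0 0 _ _) rfl)
  simpa [Rejects, Accepts, exec, Config.tuple] using r.outputs (by simp [exec, length_patternMachine])

/-- Inputs outside `O` are rejected by the query. For the others the second index register counts up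
to `d + 1` and is compared with the input length; a wrong length or a failed comparison leads to
acceptance, a complete match to rejection. -/
theorem decides_patternMachine (O : Set (List ℝ)) {d : ℕ} {w : List (ℕ × ℕ)}
    (hw : ∀ q ∈ w, q.1 ≤ d ∧ q.2 ≤ 2) :
    Decides O (patternMachine d w)
      {x | x ∈ O ∧ ¬ (x.length = d + 1 ∧ ∀ q ∈ w, x.getD q.1 0 = q.2)} := by
  classical
  intro x _
  set M := patternMachine d w with hM
  have r1 : Reaches O M (init x) (exec O (init x) (.query 7 1)) := .single rfl
  simp only [exec, init_tuple] at r1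
  by_cases hx : x ∈ O
  swap
  · exact ⟨fun h => (hx h.1).elim,
      fun _ => rejects_patternMachine_of_reaches r1 (by simp [hx])⟩
  rw [if_pos hx] at r1
  have d8 : M.drop 8 = List.replicate d (.idxSucc 1) ++
      ([.ifIdx 0 1 (d + 9) 4, .setOne (d + 2), .add (d + 3) (d + 2) (d + 2)] ++
      (compareInstrs (d + 1) (d + 11) w ++ [.ifIdx 0 0 1 1])) := rfl
  have d8d : M.drop (8 + d) =
      [.ifIdx 0 1 (d + 9) 4, .setOne (d + 2), .add (d + 3) (d + 2) (d + 2)] ++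
      (compareInstrs (d + 1) (d + 11) w ++ [.ifIdx 0 0 1 1]) := by
    rw [← List.drop_drop, d8, List.drop_left' (by simp)]
  have d11 : M.drop (d + 11) = compareInstrs (d + 1) (d + 11) w ++ [.ifIdx 0 0 1 1] := by
    rw [show M.drop (d + 11) = (M.drop (8 + d)).drop 3 by
      rw [List.drop_drop]; congr 1; ring, d8d]
    rfl
  have dend : M[d + 11 + 4 * w.length]? = some (.ifIdx 0 0 1 1) := by
    rw [← List.getElem?_drop, d11, List.getElem?_append_right (by rw [length_compareInstrs]),
      length_compareInstrs]
    simp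
  have r2 := (r1.trans (.single (a := .idxOne 1) rfl)).trans
    (reaches_replicate_idxSucc O d 8 _ d8)
  have r3 := r2.trans (.single (getElem?_of_drop_eq (j := 0) d8d rfl))
  simp only [exec, init, Function.update_self, Function.update_idem, ne_eq, zero_ne_one,
    not_false_eq_true, Function.update_of_ne] at r3
  by_cases hd : x.length = 1 + d
  swap
  · rw [if_neg hd] at r3
    refine ⟨fun _ => accepts_patternMachine_of_reaches r3 rfl, fun h => (h ⟨hx, ?_⟩).elim⟩
    exact fun h => hd (by omega)
  rw [if_pos hd] at r3
  have r4 := r3.trans (.single (a := .setOne (d + 2)) (by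
    have := getElem?_of_drop_eq (j := 1) d8d rfl
    rwa [show 8 + d + 1 = d + 9 by ring] at this))
  have r5 := r4.trans (.single (a := .add (d + 3) (d + 2) (d + 2)) (by
    have := getElem?_of_drop_eq (j := 2) d8d rfl
    rwa [show 8 + d + 2 = d + 9 + 1 by ring] at this))
  simp only [exec, Function.update_self] at r5
  obtain ⟨c', r6, hc'⟩ := reaches_compareInstrs O (M := M) (m := d + 1) (fun i => x.getD i 0) w
    (fun q hq => ⟨Nat.lt_succ_of_le (hw q hq).1, (hw q hq).2⟩) _ r5 d11 (by
      intro i hi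
      dsimp only
      rw [Function.update_of_ne (by omega), Function.update_of_ne (by omega)]) (by
      intro k hk
      dsimp only
      -- The register of index `d + 1` lies just beyond the input of length `d + 1`, so it still
      -- contains its initial 0. The constants 1 and 2 were written by the program.
      interval_cases k
      · rw [Function.update_of_ne (by omega), Function.update_of_ne (by omega),
          List.getD_eq_default _ _ (by omega)]
        simp
      · rw [Function.update_of_ne (by omega), Function.update_self]
        simp
      · rw [Function.update_self]
        norm_num)
  dsimp only at hc'
  by_cases hall : ∀ q ∈ w, x.getD q.1 0 = q.2
  · rw [if_pos hall] at hc'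
    refine ⟨fun h => (h.2 ⟨by omega, hall⟩).elim, fun _ => ?_⟩
    exact rejects_patternMachine_of_reaches
      (r6.trans (.single (a := .ifIdx 0 0 1 1) (by rw [hc', dend]))) (by simp [exec])
  · rw [if_neg hall] at hc'
    exact ⟨fun _ => accepts_patternMachine_of_reaches r6 hc',
      fun h => (h ⟨hx, fun h' => hall h'.2⟩).elim⟩

/-! ### Reduction of `haltEq` to the first level -/

/-- This puts the tuples (2, 1, y, code) into the form checked by `patternMachine`. Index 2 is left
out because `y` is arbitrary; the code starts at index 3. -/
theorem eq_cons_cons_cons_append_iff {x : List ℝ} {k : List ℕ} :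
    (∃ y : ℝ, x = (2 : ℝ) :: ([1, y] ++ k.map Nat.cast)) ↔
      x.length = k.length + 2 + 1 ∧ ∀ q ∈ (0, 2) :: (1, 1) ::
        (List.range k.length).map (fun j => (j + 3, k.getD j 0)), x.getD q.1 0 = (q.2 : ℝ) := by
  constructor
  · rintro ⟨y, rfl⟩
    refine ⟨by simp, ?_⟩
    simp only [List.forall_mem_cons, List.forall_mem_map, List.mem_range]
    refine ⟨by simp, by simp, fun j hj => ?_⟩
    simp [hj]
  · rintro ⟨hl, h⟩
    simp only [List.forall_mem_cons, List.forall_mem_map, List.mem_range] at h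
    obtain ⟨h0, h1, h⟩ := h
    obtain _ | ⟨a, _ | ⟨b, _ | ⟨y, u⟩⟩⟩ := x <;> simp at hl
    refine ⟨y, ?_⟩
    simp at h0 h1
    subst h0 h1
    simp only [List.cons_append, List.nil_append, List.cons.injEq, true_and]
    refine List.ext_getElem (by simp [hl]) fun j hj hj' => ?_
    have := h j (by omega)
    simpa [hj, hl ▸ hj] using this

theorem reducible_haltEq_haltLevel_one {K : Machine} (hK : SemiDecides K notRoot) :
    Reducible haltEq (haltLevel K 1) := by
  -- If `K` is an equality machine, its halting tuples already belong to `haltEq` and the two sets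
  -- coincide, so this case need not be excluded. Otherwise no tuple ending in `code K` after (2, 1,
  -- y) is in `haltEq`, and removing all of them from the first level leaves exactly `haltEq`.
  by_cases hE : IsEqMachine K
  · have hsub : haltLevel K 1 = haltEq := by
      rw [haltLevel_one, Set.union_eq_left]
      rintro z ⟨x, hx, rfl⟩
      rw [Nat.cast_one, cons_cons_cons_code_mem_haltEq]
      obtain ⟨t, ht, -⟩ := (hK [1, x] (by simp)).1 ⟨1, le_rfl, x, hx, by simp⟩
      exact ⟨hE, t, ht⟩
    -- The pattern asks the first entry to be both 0 and 1; nothing matches it, so the machine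
    -- decides its own oracle.
    refine ⟨patternMachine 0 [(0, 0), (0, 1)], isOrdOracleMachine_patternMachine _ _, ?_⟩
    convert decides_patternMachine (haltLevel K 1) (d := 0) (w := [(0, 0), (0, 1)])
      (by simp) using 1
    ext z
    simp only [hsub, Set.mem_ofPred_eq, List.forall_mem_cons]
    refine ⟨fun h => ⟨h, ?_⟩, fun h => h.1⟩
    rintro ⟨-, h0, h1, -⟩
    rw [h0] at h1
    norm_num at h1
  · obtain ⟨k, hk, hk2⟩ := exists_code_eq_map_natCast K
    refine ⟨patternMachine (k.length + 2) ((0, 2) :: (1, 1) ::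
      (List.range k.length).map (fun j => (j + 3, k.getD j 0))),
      isOrdOracleMachine_patternMachine _ _, ?_⟩
    convert decides_patternMachine (haltLevel K 1) ?_ using 1
    · ext z
      rw [Set.mem_ofPred_eq, ← eq_cons_cons_cons_append_iff, ← hk, haltLevel_one]
      constructor
      · refine fun h => ⟨.inl h, ?_⟩
        rintro ⟨y, rfl⟩
        exact hE (cons_cons_cons_code_mem_haltEq.1 h).1
      · rintro ⟨h | ⟨y, -, h⟩, h'⟩
        · exact h
        · exact (h' ⟨y, by simpa using h⟩).elim
    · simp only [List.forall_mem_cons, List.forall_mem_map, List.mem_range]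
      refine ⟨by simp, by simp, fun j hj => ⟨by omega, hk2 _ ?_⟩⟩
      rw [List.getD_eq_getElem _ _ hj]
      exact List.getElem_mem hj

end AddBSS

theorem mainTheorem7 :
    (∀ (M : AddBSS.Machine) (S : Set ℝ), AddBSS.IsOrdOracleMachine M →
      AddBSS.Decides AddBSS.haltEq M (AddBSS.asProblem S) →
      ∃ n m : ℕ, 0 < n ∧ 0 < m ∧
        ((AddBSS.Rejects AddBSS.haltEq M [Real.sqrt 2] ∧
            AddBSS.Rejects AddBSS.haltEq M [(n : ℝ) / (m : ℝ) * Real.pi]) ∨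
          (AddBSS.Accepts AddBSS.haltEq M [Real.sqrt 2] ∧
            AddBSS.Accepts AddBSS.haltEq M [(n : ℝ) / (m : ℝ) * Real.pi]))) ∧
    ¬ AddBSS.Reducible (AddBSS.asProblem {Real.sqrt 2}) AddBSS.haltEq ∧
    (∃ K : AddBSS.Machine, AddBSS.IsOrdMachine K ∧ AddBSS.SemiDecides K AddBSS.notRoot) ∧
    (∀ K : AddBSS.Machine, AddBSS.IsOrdMachine K → AddBSS.SemiDecides K AddBSS.notRoot →
      AddBSS.StrictlyReducible AddBSS.haltEq (AddBSS.haltLevel K 1)) := by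
  refine ⟨fun M S _ hS => ?_, AddBSS.not_reducible_singleton_sqrt_two,
    ⟨_, AddBSS.isOrdMachine_rootMachine, AddBSS.semiDecides_rootMachine⟩,
    fun K _ hK => ⟨AddBSS.reducible_haltEq_haltLevel_one hK,
      AddBSS.not_reducible_haltLevel_one hK⟩⟩
  obtain ⟨n, m, hn, hm, -, h⟩ := AddBSS.exists_rat_mul_pi_agree hS
  exact ⟨n, m, hn, hm, h⟩
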